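/- For $L\ge 2$ let $\Lambda=(\mathbb Z/L\mathbb Z)^2$ be the two-dimensional discrete torus of side length $L$, regarded as a simple graph in which two distinct vertices are adjacent iff they differ by plus or minus a standard basis vector. For $\beta>0$ and $h\ge 0$ let $\mathbb P_{\beta,h}$ be the arboreal gas on $\Lambda$, i.e. the probability measure on the set of forests $F$ of $\Lambda$ (spanning subgraphs without cycles) given by $$\mathbb P_{\beta,h}[F]=\frac1{Z_{\beta,h}}\,\beta^{|F|}\prod_{T\in F}(1+h|T|),$$ where $|F|$ is the number of edges of $F$, the product runs over the trees (connected components) $T$ of $F$, $|T|$ is the number of vertices of $T$, and $Z_{\beta,h}$ is the normalising constant; thus $\mathbb P_{\beta,0}[F]\propto\beta^{|F|}$. Let $\mathbb E_{\beta,h}$ be the corresponding expectation and $T_0$ the tree of $F$ containing the vertex $0$. Then for every $\beta_0>0$ there is a constant $C>0$, depending only on $\beta_0$, such that for all $0<\beta\le\beta_0$ and all integers $L\ge 2$, $$\mathbb E_{\beta,0}\frac{|T_0|}{|\Lambda|}\le \frac{C}{\sqrt{\log L}}.$$ -/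

import Mathlib

namespace ArborealGas

open Finset

/-- The `d`-dimensional discrete torus of side length `L`: the vertex set is `(ℤ/Lℤ)^d`, and two
distinct vertices are joined by an edge iff they differ by plus or minus a standard basis vector. -/
def torusGraph (d L : ℕ) : SimpleGraph (Fin d → ZMod L) :=
  SimpleGraph.fromRel fun x y => ∃ i : Fin d, y = x + Pi.single i 1

section General

variable {V : Type*} [Fintype V]

open Classical in
/-- The set of forests of a finite graph `G = (V, E)`: all spanning subgraphs `(V, E')` with
`E' ⊆ E` that contain no cycle. -/
noncomputable def forests (G : SimpleGraph V) : Finset (SimpleGraph V) :=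
  {F | F ≤ G ∧ F.IsAcyclic}

/-- The tree of `F` containing the vertex `v`, as a set of vertices. -/
def treeAt (F : SimpleGraph V) (v : V) : Set V :=
  (F.connectedComponentMk v).supp

open Classical in
/-- The weight `β ^ |F| * ∏_{T ∈ F} (1 + h |T|)` of a forest `F`, where `|F|` is the number of
edges and the product runs over the trees `T` (connected components) of `F`, with `|T|` the number
of vertices of `T`. -/
noncomputable def weight (β h : ℝ) (F : SimpleGraph V) : ℝ :=
  β ^ F.edgeSet.ncard * ∏ T : F.ConnectedComponent, (1 + h * (T.supp.ncard : ℝ))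

/-- The partition function `Z_{β,h}` of the arboreal gas on `G`. -/
noncomputable def partitionFunction (G : SimpleGraph V) (β h : ℝ) : ℝ :=
  ∑ F ∈ forests G, weight β h F

/-- The probability `ℙ_{β,h}[F]` of a forest `F` of `G` under the arboreal gas. -/
noncomputable def prob (G : SimpleGraph V) (β h : ℝ) (F : SimpleGraph V) : ℝ :=
  weight β h F / partitionFunction G β h

/-- The expectation `𝔼_{β,h} X` of a random variable `X` under the arboreal gas on `G`. -/
noncomputable def expectation (G : SimpleGraph V) (β h : ℝ) (X : SimpleGraph V → ℝ) : ℝ :=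
  ∑ F ∈ forests G, prob G β h F * X F

end General

end ArborealGas

/-! A Mermin–Wagner type argument. Take `g` with `g o = 0`. For `i` in the tree of `o`, `g i` is the
sum of the increments of `g` along the path from `i` to `o` (`sum_gradient_path`). Cutting a path
edge `uv` turns the weighted sum over forests into a sum over forests in which `u` and `v` lie in
different trees, at the cost of a factor `β` (`sum_forests_sum_cut`). After cutting, the total is a
sum over trees `T` of `|T|` times the flux of `∇g` from `T` to the tree of `o`.

Cauchy–Schwarz over trees (`sq_sum_flux_le`) leaves the squared fluxes. Gluing the cut edge back
turns one factor of each flux into an increment along a forest edge, and a symmetrisation bounds the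
result by the Dirichlet energy of `g` (`sum_flux_cut_le`). Hence `√(β * energy G g)` bounds the
expected sum of `g` over the tree of `o`, divided by the number of vertices (`sq_sum_forests_le`).

On the torus, `g = log (1 + torusNorm)` has energy of order `log L`, yet is at least `log L / 2`
outside a negligible set of vertices; dividing gives `1 / √(log L)`. -/

namespace ArborealGas

open Finset

/-! ### Cutting edges of forests, and path sums. -/

section Forests

open scoped Classical

variable {V : Type*}

/-- The graph `F` with the edge `uv` removed. -/
def cut (F : SimpleGraph V) (u v : V) : SimpleGraph V := F.deleteEdges {s(u, v)}

theorem cut_comm (F : SimpleGraph V) (u v : V) : cut F u v = cut F v u := by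
  rw [cut, cut, Sym2.eq_swap]

/-- Follow a walk from `b` to `u` until it first meets `u` or `v`; up to that point it does not use
the edge `uv`. -/
theorem cut_reachable_or {F : SimpleGraph V} {u b : V} (v : V) (h : F.Reachable u b) :
    (cut F u v).Reachable u b ∨ (cut F u v).Reachable v b := by
  obtain ⟨p⟩ := h.symm
  suffices ∀ (x y : V) (_ : F.Walk x y), y = u →
      (cut F u v).Reachable u x ∨ (cut F u v).Reachable v x from this _ _ p rfl
  intro x y p
  induction p with
  | nil => rintro rfl; exact Or.inl (.refl _)
  | @cons x z w hxz p ih =>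
    intro hw
    by_cases hxu : x = u
    · exact Or.inl (hxu ▸ .refl _)
    by_cases hxv : x = v
    · exact Or.inr (hxv ▸ .refl _)
    have hadj : (cut F u v).Adj z x := by
      simp only [cut, SimpleGraph.deleteEdges_adj, Set.mem_singleton_iff, Sym2.eq_iff]
      exact ⟨hxz.symm, by tauto⟩
    exact (ih hw).imp (fun h => h.trans hadj.reachable) fun h => h.trans hadj.reachable

theorem not_cut_reachable {F : SimpleGraph V} (hF : F.IsAcyclic) {u v : V} (h : F.Adj u v) :
    ¬ (cut F u v).Reachable u v :=
  SimpleGraph.isBridge_iff.1 (SimpleGraph.isAcyclic_iff_forall_adj_isBridge.1 hF h)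

theorem reachable_of_cut {F : SimpleGraph V} {u v a b : V} (h : (cut F u v).Reachable a b) :
    F.Reachable a b :=
  h.mono (SimpleGraph.deleteEdges_le _)

theorem cut_sup_edge {F : SimpleGraph V} {u v : V} (h : ¬ F.Reachable u v) :
    cut (F ⊔ SimpleGraph.edge u v) u v = F := by
  ext a b
  have : F.Adj a b → s(a, b) ≠ s(u, v) := by
    rintro hab he
    rcases Sym2.eq_iff.1 he with ⟨rfl, rfl⟩ | ⟨rfl, rfl⟩
    · exact h hab.reachable
    · exact h hab.reachable.symm
  simp only [cut, SimpleGraph.deleteEdges_adj, SimpleGraph.sup_adj, SimpleGraph.adj_edge,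
    Set.mem_singleton_iff]
  grind

theorem sup_edge_cut {F : SimpleGraph V} {u v : V} (h : F.Adj u v) :
    cut F u v ⊔ SimpleGraph.edge u v = F := by
  ext a b
  have : s(a, b) = s(u, v) → F.Adj a b := by
    intro he
    rcases Sym2.eq_iff.1 he with ⟨rfl, rfl⟩ | ⟨rfl, rfl⟩
    · exact h
    · exact h.symm
  have := h.ne
  simp only [cut, SimpleGraph.deleteEdges_adj, SimpleGraph.sup_adj, SimpleGraph.adj_edge,
    Set.mem_singleton_iff]
  grind [SimpleGraph.Adj.ne]

variable [Fintype V]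

theorem mem_forests {G F : SimpleGraph V} : F ∈ forests G ↔ F ≤ G ∧ F.IsAcyclic := by
  simp [forests]

theorem ncard_edgeSet_cut {F : SimpleGraph V} {u v : V} (h : F.Adj u v) :
    F.edgeSet.ncard = (cut F u v).edgeSet.ncard + 1 := by
  rw [cut, SimpleGraph.edgeSet_deleteEdges, Set.ncard_sdiff_singleton_add_one]
  exact h

/-- Removing the edge `uv` is a bijection from the forests containing `uv` to the forests in which
`u` and `v` are not connected. -/
theorem sum_forests_cut {G : SimpleGraph V} (β : ℝ) {u v : V} (huv : G.Adj u v)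
    (Φ : SimpleGraph V → ℝ) :
    ∑ F ∈ forests G with F.Adj u v, β ^ F.edgeSet.ncard * Φ (cut F u v) =
      β * ∑ F ∈ forests G with ¬ F.Reachable u v, β ^ F.edgeSet.ncard * Φ F := by
  rw [mul_sum]
  refine sum_nbij' (fun F => cut F u v) (fun F => F ⊔ SimpleGraph.edge u v) ?_ ?_ ?_ ?_ ?_
  · intro F hF
    simp only [mem_filter, mem_forests] at hF ⊢
    exact ⟨⟨(SimpleGraph.deleteEdges_le _).trans hF.1.1,
      hF.1.2.anti (SimpleGraph.deleteEdges_le _)⟩, not_cut_reachable hF.1.2 hF.2⟩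
  · intro F hF
    simp only [mem_filter, mem_forests] at hF ⊢
    refine ⟨⟨sup_le hF.1.1 ((SimpleGraph.edge_le_iff _).2 (Or.inr huv)),
      hF.1.2.sup_edge_of_not_reachable hF.2⟩, Or.inr ?_⟩
    exact (SimpleGraph.edge_adj ..).2 ⟨Or.inl ⟨rfl, rfl⟩, huv.ne⟩
  · intro F hF
    exact sup_edge_cut (mem_filter.1 hF).2
  · intro F hF
    exact cut_sup_edge (mem_filter.1 hF).2
  · intro F hF
    rw [ncard_edgeSet_cut (mem_filter.1 hF).2]
    ring

/-- The cutting bijection summed over oriented edges. It is used in both directions: to cut path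
edges and, after Cauchy–Schwarz, to glue them back. -/
theorem sum_forests_sum_cut (G : SimpleGraph V) (β : ℝ) (Φ : V → V → SimpleGraph V → ℝ) :
    ∑ F ∈ forests G, β ^ F.edgeSet.ncard *
        ∑ u, ∑ v, (if F.Adj u v then Φ u v (cut F u v) else 0) =
      β * ∑ F ∈ forests G, β ^ F.edgeSet.ncard *
        ∑ u, ∑ v, (if G.Adj u v ∧ ¬ F.Reachable u v then Φ u v F else 0) := by
  simp only [mul_sum]
  rw [sum_comm, sum_comm (s := forests G)]
  refine sum_congr rfl fun u _ => ?_
  rw [sum_comm, sum_comm (s := forests G)]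
  refine sum_congr rfl fun v _ => ?_
  by_cases huv : G.Adj u v
  · have h := sum_forests_cut β huv (Φ u v)
    rw [mul_sum] at h
    simpa [huv, sum_filter, mul_ite] using h
  · have h0 : ∀ F ∈ forests G, ¬ F.Adj u v := fun F hF h => huv ((mem_forests.1 hF).1 h)
    rw [sum_eq_zero, sum_eq_zero]
    · intro F _; simp [huv]
    · intro F hF; simp [h0 F hF]

/-- In a forest, the increment of `g` between two connected vertices is the sum of its increments
along the edges of the path joining them. -/
theorem sum_gradient_path {F : SimpleGraph V} (hF : F.IsAcyclic) (g : V → ℝ) (a b : V) :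
    ∑ u, ∑ v, (if F.Adj u v then
        (if (cut F u v).Reachable a u ∧ (cut F u v).Reachable v b then g u - g v else 0) else 0) =
      if F.Reachable a b then g a - g b else 0 := by
  set D : V → ℝ := fun a => ∑ u, ∑ v, (if F.Adj u v then
    (if (cut F u v).Reachable a u ∧ (cut F u v).Reachable v b then g u - g v else 0) else 0)
    with hD
  change D a = _
  have hzero : ∀ a, (∀ u v, F.Adj u v →
      ¬ ((cut F u v).Reachable a u ∧ (cut F u v).Reachable v b)) → D a = 0 := by
    intro a h
    refine sum_eq_zero fun u _ => sum_eq_zero fun v _ => ?_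
    split_ifs with h1 h2
    · exact absurd h2 (h u v h1)
    all_goals rfl
  have hstep : ∀ a c, F.Adj a c → F.Reachable c b → D a - D c = g a - g c := by
    intro a c hac hcb
    have hn := not_cut_reachable hF hac
    -- Cutting any edge other than `ac` leaves `a` and `c` connected, so only the two orientations
    -- of `ac` contribute to `D a - D c`.
    have hterm : ∀ u v, ((if F.Adj u v then
          (if (cut F u v).Reachable a u ∧ (cut F u v).Reachable v b then g u - g v else 0) else 0) -
        (if F.Adj u v then
          (if (cut F u v).Reachable c u ∧ (cut F u v).Reachable v b then g u - g v else 0) else 0))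
        = (if u = a then (if v = c then
            (if (cut F a c).Reachable c b then g a - g c else 0) else 0) else 0) +
          (if u = c then (if v = a then
            (if (cut F a c).Reachable a b then g a - g c else 0) else 0) else 0) := by
      intro u v
      by_cases h1 : u = a ∧ v = c
      · obtain ⟨rfl, rfl⟩ := h1
        have := hac.ne
        have hn' : ¬ (cut F u v).Reachable v u := fun h => hn h.symm
        simp only [hac, hn', this, if_true, false_and, if_false, sub_zero, add_zero,
          SimpleGraph.Reachable.refl, true_and]
      by_cases h2 : u = c ∧ v = a
      · obtain ⟨rfl, rfl⟩ := h2
        have := hac.ne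
        simp only [cut_comm F u v, hac.symm, hn, this.symm, if_true, false_and, if_false,
          zero_sub, zero_add, SimpleGraph.Reachable.refl, true_and]
        split_ifs <;> ring
      have hadj : (cut F u v).Reachable a c := by
        apply SimpleGraph.Adj.reachable
        simp only [cut, SimpleGraph.deleteEdges_adj, Set.mem_singleton_iff, Sym2.eq_iff]
        exact ⟨hac, by tauto⟩
      have hiff : (cut F u v).Reachable a u ↔ (cut F u v).Reachable c u :=
        ⟨fun h => hadj.symm.trans h, fun h => hadj.trans h⟩
      simp only [hiff, sub_self]
      by_cases h3 : u = a <;> by_cases h4 : u = c <;> simp_all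
    have : D a - D c = (if (cut F a c).Reachable c b then g a - g c else 0) +
        (if (cut F a c).Reachable a b then g a - g c else 0) := by
      simp only [hD, ← sum_sub_distrib]
      simp only [hterm, sum_add_distrib]
      simp
    rw [this]
    -- After `ac` is cut, `b` lies on exactly one side, so exactly one of the two terms survives.
    rcases cut_reachable_or c (hac.reachable.trans hcb) with h | h
    · have h' : ¬ (cut F a c).Reachable c b := fun h' => hn (h.trans h'.symm)
      simp [h, h']
    · have h' : ¬ (cut F a c).Reachable a b := fun h' => hn (h'.trans h.symm)
      simp [h, h']
  split_ifs with hab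
  · obtain ⟨p⟩ := hab
    clear_value D
    induction p with
    | nil =>
      rw [sub_self]
      refine hzero _ fun u v huv h => not_cut_reachable hF huv (h.1.symm.trans h.2.symm)
    | cons hadj p ih =>
      have h1 := hstep _ _ hadj ⟨p⟩
      have h2 := ih hD hzero hstep
      linarith
  · refine hzero a fun u v huv h => hab ?_
    exact (reachable_of_cut h.1).trans (huv.reachable.trans (reachable_of_cut h.2))

end Forests

/-! ### The energy inequality on a general finite graph. -/

section Inequality

open scoped Classical

variable {V : Type*} [Fintype V]

/-- The Dirichlet energy of `g` on the graph `G`. -/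
noncomputable def energy (G : SimpleGraph V) (g : V → ℝ) : ℝ :=
  (∑ a, ∑ b, if G.Adj a b then (g a - g b) ^ 2 else 0) / 2

/-- The sum of the increments of `g` along the part of the path from `a` to `o` that lies on the
path from `a` to `b`. -/
noncomputable def commonIncrement (F : SimpleGraph V) (g : V → ℝ) (o a b : V) : ℝ :=
  ∑ u, ∑ v, (if F.Adj u v then
    (if (cut F u v).Reachable a u ∧ (cut F u v).Reachable v o ∧ (cut F u v).Reachable b o
      then g u - g v else 0) else 0)

/-- The paths from `a` and `b` to `o` merge at some vertex. The two terms are the increments from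
`a` and from `b` down to it, so the difference telescopes along the path from `a` to `b`. -/
theorem commonIncrement_sub {F : SimpleGraph V} (hF : F.IsAcyclic) (g : V → ℝ) (o a b : V) :
    commonIncrement F g o a b - commonIncrement F g o b a =
      if F.Reachable a b ∧ F.Reachable a o then g a - g b else 0 := by
  have hcomm : commonIncrement F g o b a = ∑ u, ∑ v, (if F.Adj u v then
      (if (cut F u v).Reachable b v ∧ (cut F u v).Reachable u o ∧ (cut F u v).Reachable a o
        then g v - g u else 0) else 0) := by
    rw [commonIncrement, sum_comm]
    refine sum_congr rfl fun u _ => sum_congr rfl fun v _ => ?_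
    simp only [cut_comm F v u, F.adj_comm v u]
  rw [hcomm, commonIncrement]
  simp only [← sum_sub_distrib]
  by_cases hao : F.Reachable a o
  · simp only [hao, and_true]
    rw [← sum_gradient_path hF g a b]
    refine sum_congr rfl fun u _ => sum_congr rfl fun v _ => ?_
    by_cases huv : F.Adj u v
    · have hn := not_cut_reachable hF huv
      simp only [huv, if_true]
      by_cases hv : (cut F u v).Reachable v o
      · have hu : ¬ (cut F u v).Reachable u o := fun h => hn (h.trans hv.symm)
        have : (cut F u v).Reachable b o ↔ (cut F u v).Reachable v b :=
          ⟨fun h => hv.trans h.symm, fun h => h.symm.trans hv⟩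
        simp [hv, hu, this]
      by_cases hu : (cut F u v).Reachable u o
      · have h1 : (cut F u v).Reachable a o ↔ (cut F u v).Reachable a u :=
          ⟨fun h => h.trans hu.symm, fun h => h.trans hu⟩
        have h2 : (cut F u v).Reachable b v ↔ (cut F u v).Reachable v b :=
          ⟨fun h => h.symm, fun h => h.symm⟩
        simp only [hv, hu, h1, h2, and_comm, true_and, false_and, if_false, zero_sub]
        split_ifs <;> ring
      · have : ¬ (cut F u v).Reachable a u := by
          intro h
          rcases cut_reachable_or v ((reachable_of_cut h).symm.trans hao) with h | h
          · exact hu h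
          · exact hv h
        simp [hv, hu, this]
    · simp [huv]
  · simp only [hao, and_false, if_false]
    refine sum_eq_zero fun u _ => sum_eq_zero fun v _ => ?_
    have h1 : ¬ (cut F u v).Reachable a o := fun h => hao (reachable_of_cut h)
    by_cases huv : F.Adj u v
    · have h2 : ¬ ((cut F u v).Reachable a u ∧ (cut F u v).Reachable v o ∧
          (cut F u v).Reachable b o) := fun h =>
        hao ((reachable_of_cut h.1).trans (huv.reachable.trans (reachable_of_cut h.2.1)))
      simp [h1, h2]
    · simp [huv]

/-- The boundary flux of `∇g` from the tree of `u` to the tree of `o`. -/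
noncomputable def flux (G H : SimpleGraph V) (g : V → ℝ) (o u : V) : ℝ :=
  ∑ a, ∑ b, if G.Adj a b ∧ H.Reachable a u ∧ H.Reachable b o then g a - g b else 0

theorem sum_sum_comm (f : V → V → V → V → ℝ) :
    ∑ u, ∑ v, ∑ a, ∑ b, f u v a b = ∑ a, ∑ b, ∑ u, ∑ v, f u v a b := by
  calc _ = ∑ u, ∑ a, ∑ b, ∑ v, f u v a b := sum_congr rfl fun u _ => by
        rw [sum_comm]
        exact sum_congr rfl fun a _ => sum_comm
    _ = _ := by
        rw [sum_comm]
        exact sum_congr rfl fun a _ => sum_comm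

/-- Exchanging the sums over forest edges `uv` and graph edges `ab` produces `commonIncrement F g o
a b`. Averaging over the two orientations of `ab` replaces it by half of `g a - g b` or by zero, so
a nonnegative part of the energy remains. -/
theorem sum_flux_cut_le (G : SimpleGraph V) {F : SimpleGraph V} (hF : F.IsAcyclic) (g : V → ℝ)
    (o : V) :
    ∑ u, ∑ v, (if F.Adj u v then (if (cut F u v).Reachable v o then
      (g u - g v) * flux G (cut F u v) g o u else 0) else 0) ≤ energy G g := by
  have h1 : ∑ u, ∑ v, (if F.Adj u v then (if (cut F u v).Reachable v o then
      (g u - g v) * flux G (cut F u v) g o u else 0) else 0) =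
      ∑ a, ∑ b, (if G.Adj a b then (g a - g b) * commonIncrement F g o a b else 0) := by
    calc _ = ∑ u, ∑ v, ∑ a, ∑ b, (if F.Adj u v ∧ G.Adj a b ∧ (cut F u v).Reachable a u ∧
              (cut F u v).Reachable v o ∧ (cut F u v).Reachable b o
              then (g a - g b) * (g u - g v) else 0) := by
          refine sum_congr rfl fun u _ => sum_congr rfl fun v _ => ?_
          by_cases h : F.Adj u v
          · by_cases h' : (cut F u v).Reachable v o
            · simp only [h, h', if_true, flux, mul_sum, true_and]
              refine sum_congr rfl fun a _ => sum_congr rfl fun b _ => ?_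
              split_ifs <;> ring
            · simp [h, h']
          · simp [h]
      _ = ∑ a, ∑ b, ∑ u, ∑ v, (if F.Adj u v ∧ G.Adj a b ∧ (cut F u v).Reachable a u ∧
              (cut F u v).Reachable v o ∧ (cut F u v).Reachable b o
              then (g a - g b) * (g u - g v) else 0) := by
          exact sum_sum_comm _
      _ = _ := by
          refine sum_congr rfl fun a _ => sum_congr rfl fun b _ => ?_
          by_cases h : G.Adj a b
          · simp only [h, if_true, commonIncrement, mul_sum, true_and]
            refine sum_congr rfl fun u _ => sum_congr rfl fun v _ => ?_
            by_cases h' : F.Adj u v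
            · simp only [h', if_true, true_and]
              split_ifs <;> ring
            · simp [h']
          · simp [h]
  have h2 : ∑ a, ∑ b, (if G.Adj a b then (g a - g b) * commonIncrement F g o a b else 0) =
      ∑ a, ∑ b, (if G.Adj a b then (g a - g b) * -commonIncrement F g o b a else 0) := by
    rw [sum_comm]
    refine sum_congr rfl fun u _ => sum_congr rfl fun v _ => ?_
    simp only [G.adj_comm v u]
    split_ifs <;> ring
  have h3 : ∑ a, ∑ b, (if G.Adj a b then (g a - g b) * commonIncrement F g o a b else 0) +
      ∑ a, ∑ b, (if G.Adj a b then (g a - g b) * -commonIncrement F g o b a else 0) ≤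
      ∑ a, ∑ b, if G.Adj a b then (g a - g b) ^ 2 else 0 := by
    simp only [← sum_add_distrib]
    refine sum_le_sum fun a _ => sum_le_sum fun b _ => ?_
    split_ifs with h
    · rw [← mul_add, ← sub_eq_add_neg, commonIncrement_sub hF]
      split_ifs
      · rw [sq]
      · rw [mul_zero]; positivity
    · simp
  rw [h1, energy]
  linarith

theorem sum_fiber_mul_sum_fiber {ι κ C : Type*} [Fintype ι] [Fintype κ] [Fintype C]
    (p : ι → C) (q : κ → C) (x : ι → ℝ) (y : κ → ℝ) :
    ∑ c, (∑ i, if p i = c then x i else 0) * (∑ k, if q k = c then y k else 0) =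
      ∑ i, ∑ k, if p i = q k then x i * y k else 0 := by
  simp only [sum_mul_sum]
  rw [sum_comm]
  refine sum_congr rfl fun i _ => ?_
  rw [sum_comm]
  refine sum_congr rfl fun k _ => ?_
  simp [ite_mul, eq_comm]

/-- The Cauchy–Schwarz inequality over the trees of `F`. -/
theorem sq_sum_flux_le (G F : SimpleGraph V) (g : V → ℝ) (o : V) :
    (∑ u, ∑ v, if G.Adj u v ∧ ¬ F.Reachable u v then
        (∑ i, if F.Reachable i u ∧ F.Reachable v o then g u - g v else 0) else 0) ^ 2 ≤
      (Fintype.card V : ℝ) ^ 2 *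
      ∑ u, ∑ v, if G.Adj u v ∧ ¬ F.Reachable u v then
        (if F.Reachable v o then (g u - g v) * flux G F g o u else 0) else 0 := by
  set y : V × V → ℝ := fun d =>
    if G.Adj d.1 d.2 ∧ ¬ F.Reachable d.1 d.2 ∧ F.Reachable d.2 o then g d.1 - g d.2 else 0 with hy
  set n : F.ConnectedComponent → ℝ := fun c =>
    ∑ i, if F.connectedComponentMk i = c then 1 else 0 with hn
  set Y : F.ConnectedComponent → ℝ := fun c =>
    ∑ d : V × V, if F.connectedComponentMk d.1 = c then y d else 0 with hY
  -- `n c` is the size of the tree `c`, and `Y c` is the flux of `∇g` from `c` into the tree of `o`.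
  have hK : ∑ u, ∑ v, (if G.Adj u v ∧ ¬ F.Reachable u v then
      (∑ i, if F.Reachable i u ∧ F.Reachable v o then g u - g v else 0) else 0) =
      ∑ c, n c * Y c := by
    rw [sum_fiber_mul_sum_fiber]
    refine Eq.trans ?_ sum_comm
    rw [Fintype.sum_prod_type]
    refine sum_congr rfl fun u _ => sum_congr rfl fun v _ => ?_
    by_cases h : G.Adj u v ∧ ¬ F.Reachable u v
    · rw [if_pos h]
      refine sum_congr rfl fun i _ => ?_
      simp only [hy, h, true_and, SimpleGraph.ConnectedComponent.eq, one_mul, not_false_eq_true]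
      by_cases h1 : F.Reachable i u <;> simp [h1]
    · rw [if_neg h, sum_eq_zero]
      intro i _
      have : y (u, v) = 0 := if_neg fun h' => h ⟨h'.1, h'.2.1⟩
      simp [this]
  have hQ : ∑ u, ∑ v, (if G.Adj u v ∧ ¬ F.Reachable u v then
      (if F.Reachable v o then (g u - g v) * flux G F g o u else 0) else 0) =
      ∑ c, Y c ^ 2 := by
    simp only [sq]
    rw [sum_fiber_mul_sum_fiber, Fintype.sum_prod_type]
    refine sum_congr rfl fun u _ => sum_congr rfl fun v _ => ?_
    by_cases h : (G.Adj u v ∧ ¬ F.Reachable u v) ∧ F.Reachable v o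
    · rw [if_pos h.1, if_pos h.2, flux, mul_sum, Fintype.sum_prod_type]
      refine sum_congr rfl fun a _ => ?_
      rw [mul_sum]
      refine sum_congr rfl fun b _ => ?_
      have hyuv : y (u, v) = g u - g v := if_pos ⟨h.1.1, h.1.2, h.2⟩
      rw [hyuv]
      simp only [SimpleGraph.ConnectedComponent.eq, F.reachable_comm (u := u) (v := a), hy]
      by_cases h1 : F.Reachable a u
      · have h2 : F.Reachable b o → ¬ F.Reachable a b := fun hb hab =>
          h.1.2 (h1.symm.trans (hab.trans (hb.trans h.2.symm)))
        by_cases hb : F.Reachable b o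
        · simp [h1, hb, h2 hb]
        · simp [h1, hb]
      · simp [h1]
    · have hyuv : y (u, v) = 0 := if_neg fun h' => h ⟨⟨h'.1, h'.2.1⟩, h'.2.2⟩
      rw [sum_eq_zero]
      · split_ifs <;> tauto
      · intro k _; simp [hyuv]
  -- The sum of squared tree sizes counts the ordered pairs of vertices in a common tree.
  have hnn : ∑ c, n c ^ 2 ≤ (Fintype.card V : ℝ) ^ 2 := by
    simp only [sq]
    rw [sum_fiber_mul_sum_fiber]
    calc _ ≤ ∑ i : V, ∑ j : V, (1 : ℝ) := by
          refine sum_le_sum fun i _ => sum_le_sum fun j _ => ?_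
          split_ifs <;> norm_num
      _ = _ := by simp
  rw [hK, hQ]
  exact (sum_mul_sq_le_sq_mul_sq _ _ _).trans
    (mul_le_mul_of_nonneg_right hnn (sum_nonneg fun _ _ => sq_nonneg _))

/-- If `g` vanishes at the root `o`, the expectation of the sum of `g` over the tree of `o` is
bounded by the square root of the Dirichlet energy of `g`. -/
theorem sq_sum_forests_le (G : SimpleGraph V) {β : ℝ} (hβ : 0 < β) {o : V} {g : V → ℝ}
    (hg : g o = 0) :
    (∑ F ∈ forests G, β ^ F.edgeSet.ncard * ∑ i, if F.Reachable i o then g i else 0) ^ 2 ≤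
      β * (Fintype.card V : ℝ) ^ 2 * energy G g * (∑ F ∈ forests G, β ^ F.edgeSet.ncard) ^ 2 := by
  set Z := ∑ F ∈ forests G, β ^ F.edgeSet.ncard with hZ
  have hZ0 : 0 ≤ Z := sum_nonneg fun F _ => by positivity
  set K : SimpleGraph V → ℝ := fun F => ∑ u, ∑ v, if G.Adj u v ∧ ¬ F.Reachable u v then
    (∑ i, if F.Reachable i u ∧ F.Reachable v o then g u - g v else 0) else 0 with hK
  set Q : SimpleGraph V → ℝ := fun F => ∑ u, ∑ v, if G.Adj u v ∧ ¬ F.Reachable u v then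
    (if F.Reachable v o then (g u - g v) * flux G F g o u else 0) else 0 with hQ
  have hA : ∑ F ∈ forests G, β ^ F.edgeSet.ncard * ∑ i, (if F.Reachable i o then g i else 0) =
      β * ∑ F ∈ forests G, β ^ F.edgeSet.ncard * K F := by
    rw [← sum_forests_sum_cut G β fun u v H =>
      ∑ i, if H.Reachable i u ∧ H.Reachable v o then g u - g v else 0]
    refine sum_congr rfl fun F hF => ?_
    congr 1
    have h1 : ∀ i, (if F.Reachable i o then g i else 0) = ∑ u, ∑ v, (if F.Adj u v then
        (if (cut F u v).Reachable i u ∧ (cut F u v).Reachable v o then g u - g v else 0)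
        else 0) := by
      intro i
      rw [sum_gradient_path (mem_forests.1 hF).2, hg, sub_zero]
    simp only [h1]
    rw [sum_comm]
    refine sum_congr rfl fun u _ => ?_
    rw [sum_comm]
    refine sum_congr rfl fun v _ => ?_
    split_ifs <;> simp
  -- The bijection is read backwards here, restoring the cut edge.
  have hB : β * ∑ F ∈ forests G, β ^ F.edgeSet.ncard * Q F ≤ Z * energy G g := by
    rw [← sum_forests_sum_cut G β fun u v H =>
      if H.Reachable v o then (g u - g v) * flux G H g o u else 0, hZ, sum_mul]
    refine sum_le_sum fun F hF => ?_
    exact mul_le_mul_of_nonneg_left (sum_flux_cut_le G (mem_forests.1 hF).2 g o) (by positivity)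
  -- A second Cauchy–Schwarz, now over forests with weights `β ^ |F|`.
  have hC : (∑ F ∈ forests G, β ^ F.edgeSet.ncard * K F) ^ 2 ≤
      Z * ((Fintype.card V : ℝ) ^ 2 * ∑ F ∈ forests G, β ^ F.edgeSet.ncard * Q F) := by
    rw [mul_sum]
    refine sum_sq_le_sum_mul_sum_of_sq_le_mul _ (fun F _ => by positivity) (fun F _ => ?_)
      fun F _ => ?_
    · have := (sq_nonneg _).trans (sq_sum_flux_le G F g o)
      rw [mul_left_comm]
      positivity
    · have := sq_sum_flux_le G F g o
      calc (β ^ F.edgeSet.ncard * K F) ^ 2 = (β ^ F.edgeSet.ncard) ^ 2 * K F ^ 2 := mul_pow ..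
        _ ≤ (β ^ F.edgeSet.ncard) ^ 2 * ((Fintype.card V : ℝ) ^ 2 * Q F) := by gcongr
        _ = _ := by ring
  rw [hA, mul_pow]
  calc β ^ 2 * (∑ F ∈ forests G, β ^ F.edgeSet.ncard * K F) ^ 2
      ≤ β ^ 2 * (Z * ((Fintype.card V : ℝ) ^ 2 *
          ∑ F ∈ forests G, β ^ F.edgeSet.ncard * Q F)) := by gcongr
    _ = β * Z * (Fintype.card V : ℝ) ^ 2 * (β * ∑ F ∈ forests G, β ^ F.edgeSet.ncard * Q F) := by
        ring
    _ ≤ β * Z * (Fintype.card V : ℝ) ^ 2 * (Z * energy G g) := by gcongr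
    _ = _ := by ring

end Inequality

/-! ### From the energy inequality to the expected tree size. -/

section Expectation

open scoped Classical

variable {V : Type*} [Fintype V]

theorem expectation_zero_eq (G : SimpleGraph V) (β : ℝ) (X : SimpleGraph V → ℝ) :
    expectation G β 0 X =
      (∑ F ∈ forests G, β ^ F.edgeSet.ncard * X F) / ∑ F ∈ forests G, β ^ F.edgeSet.ncard := by
  simp only [expectation, prob, partitionFunction, weight, zero_mul, add_zero, prod_const_one,
    mul_one]
  rw [sum_div]
  exact sum_congr rfl fun F _ => by ring

theorem ncard_treeAt (F : SimpleGraph V) (v : V) :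
    ((treeAt F v).ncard : ℝ) = ∑ i, if F.Reachable i v then 1 else 0 := by
  have : treeAt F v = ((univ.filter fun i => F.Reachable i v : Finset V) : Set V) := by
    ext i
    simp [treeAt]
  rw [this, Set.ncard_coe_finset, sum_boole]

theorem sum_forests_pos (G : SimpleGraph V) {β : ℝ} (hβ : 0 < β) :
    0 < ∑ F ∈ forests G, β ^ F.edgeSet.ncard :=
  sum_pos (fun F _ => by positivity)
    ⟨⊥, mem_forests.2 ⟨bot_le, SimpleGraph.isAcyclic_bot⟩⟩

/-- If `g o = 0` and `g` is at least `ℓ` up to a nonnegative error `e`, then the expected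
size of the tree of `o` is controlled by the energy of `g` and the total error. -/
theorem expectation_treeAt_le (G : SimpleGraph V) {β : ℝ} (hβ : 0 < β) {o : V} {g e : V → ℝ}
    {ℓ : ℝ} (hg : g o = 0) (he : ∀ i, 0 ≤ e i) (hge : ∀ i, ℓ ≤ g i + e i) :
    ℓ * expectation G β 0 (fun F => ((treeAt F o).ncard : ℝ) / (Fintype.card V : ℝ)) ≤
      √(β * energy G g) + (∑ i, e i) / (Fintype.card V : ℝ) := by
  have hZ := sum_forests_pos G hβ
  have hA := sq_sum_forests_le G hβ hg
  have : Nonempty V := ⟨o⟩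
  have hN : (0 : ℝ) < Fintype.card V := by exact_mod_cast Fintype.card_pos
  have hE : 0 ≤ energy G g := by
    refine div_nonneg (sum_nonneg fun a _ => sum_nonneg fun b _ => ?_) (by norm_num)
    split_ifs <;> positivity
  rw [expectation_zero_eq]
  simp only [ncard_treeAt, ← mul_div_assoc]
  rw [← sum_div]
  set Z := ∑ F ∈ forests G, β ^ F.edgeSet.ncard
  set N : ℝ := (Fintype.card V : ℝ)
  set A := ∑ F ∈ forests G, β ^ F.edgeSet.ncard * ∑ i, if F.Reachable i o then g i else 0
    with hAdef
  have hA' : A ≤ N * Z * √(β * energy G g) := by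
    refine le_of_sq_le_sq ?_ (by positivity)
    rw [mul_pow, Real.sq_sqrt (by positivity)]
    calc A ^ 2 ≤ _ := hA
      _ = _ := by ring
  have hB : ℓ * ∑ F ∈ forests G, β ^ F.edgeSet.ncard * ∑ i, (if F.Reachable i o then 1 else 0) ≤
      A + Z * ∑ i, e i := by
    rw [hAdef, sum_mul, ← sum_add_distrib, mul_sum]
    refine sum_le_sum fun F _ => ?_
    rw [mul_left_comm, ← mul_add]
    refine mul_le_mul_of_nonneg_left ?_ (by positivity)
    rw [mul_sum, ← sum_add_distrib]
    refine sum_le_sum fun i _ => ?_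
    split_ifs
    · simpa using hge i
    · simpa using he i
  rw [← mul_div_assoc, div_le_iff₀ hZ, div_le_iff₀ hN]
  calc _ ≤ _ := hB
    _ ≤ N * Z * √(β * energy G g) + Z * ∑ i, e i := by gcongr
    _ = _ := by field_simp

end Expectation

/-! ### The logarithmic test function on the two-dimensional torus. -/

section Torus

variable {L : ℕ}

/-- The sup-norm distance to the origin on the two-dimensional torus. -/
def torusNorm (x : Fin 2 → ZMod L) : ℕ :=
  max (x 0).valMinAbs.natAbs (x 1).valMinAbs.natAbs

theorem natAbs_valMinAbs_one_le [NeZero L] : (1 : ZMod L).valMinAbs.natAbs ≤ 1 := by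
  rw [ZMod.valMinAbs_natAbs_eq_min]
  refine (min_le_left _ _).trans ?_
  rw [ZMod.val_one_eq_one_mod]
  exact Nat.mod_le _ _

theorem torusNorm_le_of_adj [NeZero L] {x y : Fin 2 → ZMod L} (h : (torusGraph 2 L).Adj x y) :
    torusNorm x ≤ torusNorm y + 1 := by
  have hz : ∀ (a b : ZMod L), b.valMinAbs.natAbs ≤ 1 →
      (a + b).valMinAbs.natAbs ≤ a.valMinAbs.natAbs + 1 := fun a b hb =>
    (ZMod.natAbs_valMinAbs_add_le a b).trans ((Int.natAbs_add_le _ _).trans (by omega))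
  have h1 := natAbs_valMinAbs_one_le (L := L)
  have hx : ∃ (i : Fin 2) (c : ZMod L), c.valMinAbs.natAbs ≤ 1 ∧ x = y + Pi.single i c := by
    rw [torusGraph, SimpleGraph.fromRel_adj] at h
    obtain ⟨-, ⟨i, rfl⟩ | ⟨i, rfl⟩⟩ := h
    · exact ⟨i, -1, by simpa using h1, by simp [Pi.single_neg]⟩
    · exact ⟨i, 1, h1, rfl⟩
  obtain ⟨i, c, hc, rfl⟩ := hx
  have h2 := hz (y 0) c hc
  have h3 := hz (y 1) c hc
  fin_cases i <;> simp [torusNorm] <;> omega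

open scoped Classical in
theorem card_adj_torusGraph_le [NeZero L] (x : Fin 2 → ZMod L) :
    #{y | (torusGraph 2 L).Adj x y} ≤ 4 := by
  have : ({y | (torusGraph 2 L).Adj x y} : Finset (Fin 2 → ZMod L)) ⊆
      (univ.image fun i : Fin 2 => x + Pi.single i 1) ∪
        univ.image fun i : Fin 2 => x - Pi.single i 1 := by
    intro y hy
    rw [mem_filter, torusGraph, SimpleGraph.fromRel_adj] at hy
    obtain ⟨-, -, ⟨i, rfl⟩ | ⟨i, rfl⟩⟩ := hy
    · exact mem_union_left _ (mem_image_of_mem _ (mem_univ i))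
    · exact mem_union_right _ (mem_image.2 ⟨i, mem_univ i, by simp⟩)
  refine (card_le_card this).trans ((card_union_le _ _).trans ?_)
  have h (f : Fin 2 → Fin 2 → ZMod L) : #(univ.image f) ≤ 2 := by
    simpa using card_image_le (s := univ) (f := f)
  linarith [h fun i => x + Pi.single i 1, h fun i => x - Pi.single i 1]

theorem sum_zmod_natAbs_le [NeZero L] {f : ℕ → ℝ} (hf : ∀ i, 0 ≤ f i) :
    ∑ z : ZMod L, f z.valMinAbs.natAbs ≤ 2 * ∑ i ∈ range L, f i := by
  have hmaps : ∀ z ∈ (univ : Finset (ZMod L)), z.valMinAbs.natAbs ∈ range L := fun z _ =>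
    mem_range.2 ((ZMod.natAbs_valMinAbs_le z).trans_lt
      (Nat.div_lt_self (NeZero.pos L) one_lt_two))
  rw [← sum_fiberwise_of_maps_to hmaps, mul_sum]
  refine sum_le_sum fun i _ => ?_
  rw [sum_congr rfl fun z hz => by rw [(mem_filter.1 hz).2], sum_const, nsmul_eq_mul]
  refine mul_le_mul_of_nonneg_right ?_ (hf i)
  have : ({z | z.valMinAbs.natAbs = i} : Finset (ZMod L)) ⊆ {(i : ZMod L), -(i : ZMod L)} := by
    intro z hz
    have h := ZMod.natCast_natAbs_valMinAbs z
    rw [(mem_filter.1 hz).2] at h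
    rw [h]
    split_ifs <;> simp
  exact_mod_cast (card_le_card this).trans card_le_two

/-- Splitting by which index is the maximum, a value `i` of the maximum occurs at most `i + 1` times
in each half, which leaves twice a harmonic sum. -/
theorem sum_one_div_max_sq_le (L : ℕ) :
    ∑ i ∈ range L, ∑ j ∈ range L, 1 / (1 + ((max i j : ℕ) : ℝ)) ^ 2 ≤
      2 * (1 + Real.log L) := by
  have hH : ∑ i ∈ range L, 1 / (1 + (i : ℝ)) ≤ 1 + Real.log L := by
    have h := harmonic_le_one_add_log L
    rw [harmonic] at h
    push_cast at h
    simpa [add_comm] using h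
  have hrow : ∀ i : ℕ, ∑ j ∈ range L, (if j ≤ i then 1 / (1 + (i : ℝ)) ^ 2 else 0) ≤
      1 / (1 + (i : ℝ)) := by
    intro i
    rw [← sum_filter, sum_const, nsmul_eq_mul]
    have hcard : #{j ∈ range L | j ≤ i} ≤ i + 1 := by
      have : ({j ∈ range L | j ≤ i} : Finset ℕ) ⊆ range (i + 1) := by
        intro j hj
        simp only [mem_filter, mem_range] at hj ⊢
        omega
      simpa using card_le_card this
    have hcard' : (#{j ∈ range L | j ≤ i} : ℝ) ≤ 1 + i := by
      rw [add_comm]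
      exact_mod_cast hcard
    calc _ ≤ (1 + (i : ℝ)) * (1 / (1 + (i : ℝ)) ^ 2) := by gcongr
      _ = _ := by field_simp
  calc _ ≤ ∑ i ∈ range L, ∑ j ∈ range L, ((if j ≤ i then 1 / (1 + (i : ℝ)) ^ 2 else 0) +
          if i ≤ j then 1 / (1 + (j : ℝ)) ^ 2 else 0) := by
        refine sum_le_sum fun i _ => sum_le_sum fun j _ => ?_
        rcases le_total i j with h | h
        · rw [max_eq_right h, if_pos h]
          have : (0 : ℝ) ≤ if j ≤ i then 1 / (1 + (i : ℝ)) ^ 2 else 0 := by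
            split_ifs <;> positivity
          linarith
        · rw [max_eq_left h, if_pos h]
          have : (0 : ℝ) ≤ if i ≤ j then 1 / (1 + (j : ℝ)) ^ 2 else 0 := by
            split_ifs <;> positivity
          linarith
    _ = 2 * ∑ i ∈ range L, ∑ j ∈ range L, (if j ≤ i then 1 / (1 + (i : ℝ)) ^ 2 else 0) := by
        simp only [sum_add_distrib]
        rw [two_mul]
        congr 1
        exact sum_comm
    _ ≤ 2 * ∑ i ∈ range L, 1 / (1 + (i : ℝ)) := by
        gcongr with i
        exact hrow i
    _ ≤ _ := by gcongr

theorem sum_one_div_torusNorm_sq_le (L : ℕ) [NeZero L] :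
    ∑ x : Fin 2 → ZMod L, 1 / (1 + (torusNorm x : ℝ)) ^ 2 ≤ 8 * (1 + Real.log L) := by
  calc _ = ∑ a : ZMod L, ∑ b : ZMod L,
          1 / (1 + ((max a.valMinAbs.natAbs b.valMinAbs.natAbs : ℕ) : ℝ)) ^ 2 := by
        rw [← Fintype.sum_prod_type']
        exact Fintype.sum_equiv (finTwoArrowEquiv _) _ _ fun x => rfl
    _ ≤ ∑ a : ZMod L, 2 * ∑ j ∈ range L,
          1 / (1 + ((max a.valMinAbs.natAbs j : ℕ) : ℝ)) ^ 2 :=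
        sum_le_sum fun a _ => sum_zmod_natAbs_le
          (f := fun j => 1 / (1 + ((max a.valMinAbs.natAbs j : ℕ) : ℝ)) ^ 2)
          fun j => by positivity
    _ ≤ 2 * ∑ i ∈ range L, 2 * ∑ j ∈ range L, 1 / (1 + ((max i j : ℕ) : ℝ)) ^ 2 :=
        sum_zmod_natAbs_le (f := fun i => 2 * ∑ j ∈ range L, 1 / (1 + ((max i j : ℕ) : ℝ)) ^ 2)
          fun i => mul_nonneg zero_le_two (sum_nonneg fun j _ => by positivity)
    _ = 4 * ∑ i ∈ range L, ∑ j ∈ range L, 1 / (1 + ((max i j : ℕ) : ℝ)) ^ 2 := by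
        rw [← mul_sum]; ring
    _ ≤ 4 * (2 * (1 + Real.log L)) := by gcongr; exact sum_one_div_max_sq_le L
    _ = _ := by ring

theorem sq_log_sub_log_le {s t : ℝ} (hs : 1 ≤ s) (ht : 1 ≤ t) (hst : s ≤ t + 1)
    (hts : t ≤ s + 1) : (Real.log s - Real.log t) ^ 2 ≤ 4 * (1 / s ^ 2) := by
  have hs0 : 0 < s := by linarith
  have ht0 : 0 < t := by linarith
  have h1 : Real.log s - Real.log t ≤ 2 / s := by
    rw [← Real.log_div hs0.ne' ht0.ne']
    refine (Real.log_le_sub_one_of_pos (by positivity)).trans ?_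
    rw [div_sub_one ht0.ne', div_le_div_iff₀ ht0 hs0]
    nlinarith
  have h2 : Real.log t - Real.log s ≤ 2 / s := by
    rw [← Real.log_div ht0.ne' hs0.ne']
    refine (Real.log_le_sub_one_of_pos (by positivity)).trans ?_
    rw [div_sub_one hs0.ne']
    gcongr
    linarith
  calc _ ≤ (2 / s) ^ 2 := sq_le_sq' (by linarith) h1
    _ = _ := by ring

theorem energy_log_torusNorm_le (L : ℕ) [NeZero L] :
    energy (torusGraph 2 L) (fun x => Real.log (1 + torusNorm x)) ≤ 64 * (1 + Real.log L) := by
  classical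
  rw [energy, div_le_iff₀ two_pos]
  calc _ ≤ ∑ a : Fin 2 → ZMod L, 16 * (1 / (1 + (torusNorm a : ℝ)) ^ 2) := by
        refine sum_le_sum fun a _ => ?_
        rw [← sum_filter]
        calc _ ≤ ∑ b : Fin 2 → ZMod L with (torusGraph 2 L).Adj a b,
                4 * (1 / (1 + (torusNorm a : ℝ)) ^ 2) := by
              refine sum_le_sum fun b hb => ?_
              have hab := (mem_filter.1 hb).2
              have h1 : (torusNorm a : ℝ) ≤ torusNorm b + 1 := by
                exact_mod_cast torusNorm_le_of_adj hab
              have h2 : (torusNorm b : ℝ) ≤ torusNorm a + 1 := by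
                exact_mod_cast torusNorm_le_of_adj hab.symm
              exact sq_log_sub_log_le (by simp) (by simp) (by linarith) (by linarith)
          _ ≤ 4 * (4 * (1 / (1 + (torusNorm a : ℝ)) ^ 2)) := by
              rw [sum_const, nsmul_eq_mul]
              gcongr
              exact_mod_cast card_adj_torusGraph_le a
          _ = _ := by ring
    _ ≤ 16 * (8 * (1 + Real.log L)) := by
        rw [← mul_sum]
        gcongr
        exact sum_one_div_torusNorm_sq_le L
    _ = _ := by ring

/-- The logarithm suffices once `1 + torusNorm x ≥ √L`; below that the error term alone exceeds `log
L / 2`. This form of the error lets `sum_one_div_torusNorm_sq_le` bound its total as well as the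
energy. -/
theorem half_log_le (L : ℕ) [NeZero L] (x : Fin 2 → ZMod L) :
    Real.log L / 2 ≤ Real.log (1 + torusNorm x) +
      Real.log L / 2 * L * (1 / (1 + (torusNorm x : ℝ)) ^ 2) := by
  have hL : (1 : ℝ) ≤ L := by exact_mod_cast NeZero.one_le
  have hlog : 0 ≤ Real.log L := Real.log_nonneg hL
  rcases le_total (L : ℝ) ((1 + (torusNorm x : ℝ)) ^ 2) with h | h
  · have h1 := Real.log_le_log (by linarith) h
    rw [Real.log_pow] at h1
    push_cast at h1
    have : 0 ≤ Real.log L / 2 * L * (1 / (1 + (torusNorm x : ℝ)) ^ 2) := by positivity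
    linarith
  · have h0 : 0 ≤ Real.log (1 + torusNorm x) := Real.log_nonneg (by simp)
    have h1 : 1 ≤ L * (1 / (1 + (torusNorm x : ℝ)) ^ 2) := by
      rw [mul_one_div, one_le_div (by positivity)]
      exact h
    rw [mul_assoc]
    nlinarith

theorem expectation_torus_le {β₀ β : ℝ} (hβ : 0 < β) (hβ₀ : β ≤ β₀) (L : ℕ) [NeZero L]
    (hL : 2 ≤ L) :
    expectation (torusGraph 2 L) β 0 (fun F => ((treeAt F 0).ncard : ℝ) /
      (Fintype.card (Fin 2 → ZMod L) : ℝ)) ≤ (2 * √(192 * β₀) + 48) / √(Real.log L) := by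
  have hL' : (2 : ℝ) ≤ L := by exact_mod_cast hL
  have hℓ : 1 / 2 ≤ Real.log L := by
    have := Real.log_le_log two_pos hL'
    linarith [Real.log_two_gt_d9]
  have hℓ0 : 0 < Real.log L := by linarith
  have h := expectation_treeAt_le (torusGraph 2 L) hβ (o := 0)
    (g := fun x => Real.log (1 + torusNorm x))
    (e := fun x => Real.log L / 2 * L * (1 / (1 + (torusNorm x : ℝ)) ^ 2)) (ℓ := Real.log L / 2)
    (by simp [torusNorm]) (fun x => by positivity) (half_log_le L)
  set E := expectation (torusGraph 2 L) β 0 (fun F => ((treeAt F 0).ncard : ℝ) /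
      (Fintype.card (Fin 2 → ZMod L) : ℝ))
  have hcard : (Fintype.card (Fin 2 → ZMod L) : ℝ) = (L : ℝ) ^ 2 := by simp [ZMod.card]
  rw [← mul_sum, hcard] at h
  have hen := energy_log_torusNorm_le L
  have hS := sum_one_div_torusNorm_sq_le L
  have hlogL : Real.log L ≤ L := Real.log_le_self (by linarith)
  set ℓ := Real.log L
  have hs : √ℓ * √ℓ = ℓ := Real.mul_self_sqrt hℓ0.le
  have hs0 : 0 < √ℓ := Real.sqrt_pos.2 hℓ0
  -- Uses `ℓ ≥ 1 / 2`, which holds since `L ≥ 2`; the constant `192` below is `64 * 3`.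
  have h13 : 1 + ℓ ≤ 3 * ℓ := by linarith
  have hβ₀' : 0 ≤ β₀ := hβ.le.trans hβ₀
  have h1 : √(β * energy (torusGraph 2 L) fun x => Real.log (1 + torusNorm x)) ≤
      √(192 * β₀) * √ℓ := by
    rw [← Real.sqrt_mul (by linarith)]
    refine Real.sqrt_le_sqrt ?_
    calc _ ≤ β * (64 * (1 + ℓ)) := by gcongr
      _ ≤ β₀ * (64 * (3 * ℓ)) := by gcongr
      _ = _ := by ring
  have h2 : √ℓ * ℓ ≤ 2 * L := by
    have hsL : √(L : ℝ) * √L = L := Real.mul_self_sqrt (by linarith)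
    have hlog : ℓ ≤ 2 * √L := by
      have h3 := Real.log_le_sub_one_of_pos (Real.sqrt_pos.2 (by linarith : (0 : ℝ) < L))
      rw [Real.log_sqrt (by linarith)] at h3
      linarith
    calc √ℓ * ℓ ≤ √L * (2 * √L) := by gcongr
      _ = 2 * L := by linarith
  -- The averaged error is of order `ℓ ^ 2 / L`; `h2` crudely bounds it by a multiple of `√ℓ`,
  -- matching the energy term.
  have h3 : (ℓ / 2 * L * ∑ x : Fin 2 → ZMod L, 1 / (1 + (torusNorm x : ℝ)) ^ 2) / (L : ℝ) ^ 2 ≤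
      24 * √ℓ := by
    rw [div_le_iff₀ (by positivity)]
    calc _ ≤ ℓ / 2 * L * (8 * (3 * ℓ)) := by
          gcongr
          exact hS.trans (by linarith)
      _ = 12 * L * √ℓ * (√ℓ * ℓ) := by linear_combination (-12 * L * ℓ) * hs
      _ ≤ 12 * L * √ℓ * (2 * L) := by gcongr
      _ = _ := by ring
  rw [le_div_iff₀ hs0]
  have h4 : √ℓ * (E * √ℓ) ≤ √ℓ * (2 * √(192 * β₀) + 48) := by
    have : √ℓ * (E * √ℓ) = ℓ * E := by linear_combination E * hs
    rw [this]
    linarith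
  exact le_of_mul_le_mul_left h4 hs0

end Torus

end ArborealGas

theorem mainTheorem8 (β₀ : ℝ) (hβ₀ : 0 < β₀) :
    ∃ C : ℝ, 0 < C ∧
      ∀ β : ℝ, 0 < β → β ≤ β₀ →
        ∀ (L : ℕ) [NeZero L], 2 ≤ L →
          ArborealGas.expectation (ArborealGas.torusGraph 2 L) β 0
              (fun F => ((ArborealGas.treeAt F 0).ncard : ℝ) /
                (Fintype.card (Fin 2 → ZMod L) : ℝ))
            ≤ C / Real.sqrt (Real.log (L : ℝ)) :=
  ⟨2 * √(192 * β₀) + 48, by positivity, fun _ hβ hβ' L _ hL =>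
    ArborealGas.expectation_torus_le hβ hβ' L hL⟩
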